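/- Let $\Omega=\mathbb{R}^{\infty}$ be the space of real sequences $\omega=(\omega_1,\omega_2,\dots)$ with the product topology and its Borel $\sigma$-algebra, and let $\theta(x_1,x_2,\dots)=(x_2,x_3,\dots)$ be the shift. Let $\mathbb{E}:C_b(\Omega)\to\mathbb{R}$ be a sublinear expectation, that is, $$\mathbb{E}[f]=\sup_{P\in\Theta}E_P[f],\quad f\in C_b(\Omega),\qquad \Theta=\{P \text{ a Borel probability measure on }\Omega : E_P[f]\le\mathbb{E}[f]\ \text{for all } f\in C_b(\Omega)\}.$$ Assume that $\mathbb{E}$ is regular, i.e. $\mathbb{E}[\phi_n]\to0$ whenever $\phi_n\in C_b(\Omega)$ and $\phi_n\downarrow0$ pointwise, and that the coordinates $\xi_n(\omega)=\omega_n$ are i.i.d. under $\mathbb{E}$, i.e. for every $n\ge1$, $\mathbb{E}[\phi(\xi_n)]=\mathbb{E}[\phi(\xi_1)]$ for all bounded Lipschitz $\phi:\mathbb{R}\to\mathbb{R}$, and $$\mathbb{E}[\phi(\xi_1,\dots,\xi_n,\xi_{n+1})]=\mathbb{E}\Big[\mathbb{E}[\phi(x,\xi_{n+1})]\big|_{x=(\xi_1,\dots,\xi_n)}\Big]$$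 for all bounded Lipschitz $\phi:\mathbb{R}^{n}\times\mathbb{R}\to\mathbb{R}$. Then for every integer $d\ge1$ the limit $$\mathbb{E}^{(d)}[f]:=\lim_{n\to\infty}\frac1n\,\mathbb{E}\Big[\sum_{k=0}^{n-1}f\circ\theta^{kd}\Big],\qquad f\in C_b(\Omega),$$ exists and defines a $\theta$-invariant sublinear expectation (again in the above sense) on $C_b(\Omega)$. Let $\Theta^{(d)}$ be the set of Borel probability measures $P$ on $\Omega$ with $E_P[f]\le\mathbb{E}^{(d)}[f]$ for all $f\in C_b(\Omega)$. Moreover: 1. $\mathbb{E}$ has a periodic decomposition with respect to $\theta$: $\mathbb{E}[f\circ\theta]=\mathbb{E}[f]$ and $\mathbb{E}[f]=\sup_{d\ge1}\mathbb{E}^{(d)}[f]$ for all $f\in C_b(\Omega)$. 2. For every $d\ge1$, every extreme point $P$ of $\Theta^{(d)}$ is $\theta^d$-ergodic, i.e. $P$ is $\theta^d$-invariant and $P(A)\in\{0,1\}$ for every Borel set $A$ with $\theta^{-d}A=A$. 3. If $\mathbb{E}$ is not linear, then for every $d\ge1$ the period of $\mathbb{E}^{(d)}$ equals $d$, i.e.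 $d$ is the smallest integer $p\ge1$ such that $\mathbb{E}^{(d)}[f\circ\theta^{p}-f]=0$ for all $f\in C_b(\Omega)$. -/

import Mathlib

open MeasureTheory Filter Topology
open scoped BoundedContinuousFunction NNReal ENNReal

noncomputable section

namespace SublinearExp

section General

variable {Ω : Type*} [TopologicalSpace Ω]

/-- The function `f ∘ T` in `C_b(Ω)`. -/
def koopman (T : C(Ω, Ω)) (f : Ω →ᵇ ℝ) : Ω →ᵇ ℝ := f.compContinuous T

theorem koopman_iterate_apply (T : C(Ω, Ω)) (k : ℕ) (f : Ω →ᵇ ℝ) (ω : Ω) :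
    (koopman T)^[k] f ω = f (T^[k] ω) := by
  induction k generalizing f with
  | zero => rfl
  | succ k ih =>
    rw [Function.iterate_succ_apply, ih, Function.iterate_succ_apply']
    rfl

/-- `E[f ∘ T] = E[f]` for all `f ∈ C_b(Ω)`. -/
def IsInvariant (E : (Ω →ᵇ ℝ) → ℝ) (T : C(Ω, Ω)) : Prop :=
  ∀ f : Ω →ᵇ ℝ, E (koopman T f) = E f

/-- The component `E^{(d)}[f] = lim_n (1/n) E[∑_{k<n} f ∘ T^{kd}]`. -/
def component (E : (Ω →ᵇ ℝ) → ℝ) (T : C(Ω, Ω)) (d : ℕ) (f : Ω →ᵇ ℝ) : ℝ :=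
  limUnder atTop fun n : ℕ =>
    (1 / (n : ℝ)) * E (∑ k ∈ Finset.range n, (koopman T)^[k * d] f)

/-- `E` is `T`-invariant and `E[f] = sup_{d ≥ 1} E^{(d)}[f]` for all `f ∈ C_b(Ω)`. -/
def HasPeriodicDecomposition (E : (Ω →ᵇ ℝ) → ℝ) (T : C(Ω, Ω)) : Prop :=
  IsInvariant E T ∧
    ∀ f : Ω →ᵇ ℝ, IsLUB {c : ℝ | ∃ d : ℕ, 1 ≤ d ∧ c = component E T d f} (E f)

/-- `p` is the smallest positive integer with `E[f ∘ T^p - f] = 0` for all `f ∈ C_b(Ω)`. -/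
def HasPeriod (E : (Ω →ᵇ ℝ) → ℝ) (T : C(Ω, Ω)) (p : ℕ) : Prop :=
  IsLeast {q : ℕ | 1 ≤ q ∧ ∀ f : Ω →ᵇ ℝ, E ((koopman T)^[q] f - f) = 0} p

/-- Continuity from above along `C_b(Ω)`: `E[φ_n] → 0` whenever `φ_n ↓ 0` pointwise. -/
def IsRegular (E : (Ω →ᵇ ℝ) → ℝ) : Prop :=
  ∀ φ : ℕ → (Ω →ᵇ ℝ), Antitone φ → (∀ ω, Tendsto (fun n => φ n ω) atTop (𝓝 0)) →
    Tendsto (fun n => E (φ n)) atTop (𝓝 0)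

/-- `X` and `Y` are identically distributed under `E`. -/
def IdenticallyDistributed {A : Type*} [PseudoMetricSpace A] (E : (Ω →ᵇ ℝ) → ℝ)
    (X Y : C(Ω, A)) : Prop :=
  ∀ φ : A →ᵇ ℝ, (∃ K : ℝ≥0, LipschitzWith K φ) →
    E (φ.compContinuous X) = E (φ.compContinuous Y)

variable [MeasurableSpace Ω]

/-- The set `Θ` of probability measures `P` on `Ω` with `E_P[f] ≤ E[f]` for all `f ∈ C_b(Ω)`. -/
def dominated (E : (Ω →ᵇ ℝ) → ℝ) : Set (Measure Ω) :=
  {P | IsProbabilityMeasure P ∧ ∀ f : Ω →ᵇ ℝ, ∫ ω, f ω ∂P ≤ E f}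

/-- A sublinear expectation on `C_b(Ω)`: `E[f] = sup_{P ∈ Θ} E_P[f]`, where `Θ` is the set of all
probability measures dominated by `E`. -/
def IsSublinearExpectation (E : (Ω →ᵇ ℝ) → ℝ) : Prop :=
  ∀ f : Ω →ᵇ ℝ, IsLUB ((fun P : Measure Ω => ∫ ω, f ω ∂P) '' dominated E) (E f)

variable {E : (Ω →ᵇ ℝ) → ℝ}

theorem IsSublinearExpectation.abs_apply_le (hE : IsSublinearExpectation E)
    {f : Ω →ᵇ ℝ} {c : ℝ} (h : ∀ ω, |f ω| ≤ c) : |E f| ≤ c := by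
  have h1 : ∀ P ∈ dominated E, |∫ ω, f ω ∂P| ≤ c := by
    rintro P ⟨hP, -⟩
    simpa using norm_integral_le_of_norm_le_const (μ := P) (f := fun ω => f ω)
      (Eventually.of_forall h)
  have hne : ((fun P : Measure Ω => ∫ ω, f ω ∂P) '' dominated E).Nonempty := (hE f).nonempty
  obtain ⟨_, P, hP, rfl⟩ := hne
  refine abs_le.2 ⟨?_, (hE f).2 ?_⟩
  · exact (abs_le.1 (h1 P hP)).1.trans ((hE f).1 ⟨P, hP, rfl⟩)
  · rintro _ ⟨Q, hQ, rfl⟩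
    exact (abs_le.1 (h1 Q hQ)).2

variable [OpensMeasurableSpace Ω]

theorem IsSublinearExpectation.le_add_of_le (hE : IsSublinearExpectation E)
    {f g : Ω →ᵇ ℝ} {c : ℝ} (h : ∀ ω, f ω ≤ g ω + c) : E f ≤ E g + c := by
  refine (hE f).2 ?_
  rintro _ ⟨P, ⟨hP, hPE⟩, rfl⟩
  have hfi := f.integrable P
  have hgi := g.integrable P
  calc ∫ ω, f ω ∂P ≤ ∫ ω, (g ω + c) ∂P :=
        integral_mono hfi (hgi.add (integrable_const c)) h
    _ = ∫ ω, g ω ∂P + c := by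
        rw [integral_add hgi (integrable_const c)]; simp
    _ ≤ E g + c := by linarith [hPE g]

theorem IsSublinearExpectation.abs_sub_le (hE : IsSublinearExpectation E)
    {f g : Ω →ᵇ ℝ} {c : ℝ} (h : ∀ ω, |f ω - g ω| ≤ c) : |E f - E g| ≤ c := by
  have h1 : E f ≤ E g + c := hE.le_add_of_le fun ω => by linarith [(abs_le.1 (h ω)).2]
  have h2 : E g ≤ E f + c := hE.le_add_of_le fun ω => by linarith [(abs_le.1 (h ω)).1]
  exact abs_le.2 ⟨by linarith, by linarith⟩

variable {A B : Type*} [PseudoMetricSpace A] [PseudoMetricSpace B]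

/-- The random variable `φ(a, Y)` for a fixed value `a`. -/
def sectionAt (φ : (A × B) →ᵇ ℝ) (Y : C(Ω, B)) (a : A) : Ω →ᵇ ℝ :=
  φ.compContinuous ((ContinuousMap.const Ω a).prodMk Y)

/-- The function `a ↦ E[φ(a, Y)]`, which is bounded and continuous for bounded Lipschitz `φ`. -/
def partialExpectation (hE : IsSublinearExpectation E) (Y : C(Ω, B)) (φ : (A × B) →ᵇ ℝ)
    (hφ : ∃ K : ℝ≥0, LipschitzWith K φ) : A →ᵇ ℝ :=
  BoundedContinuousFunction.ofNormedAddCommGroup (fun a => E (sectionAt φ Y a))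
    (by
      obtain ⟨K, hK⟩ := hφ
      refine (LipschitzWith.of_dist_le_mul (K := K) fun a a' => ?_).continuous
      rw [Real.dist_eq]
      refine hE.abs_sub_le fun ω => ?_
      have := hK.dist_le_mul (a, Y ω) (a', Y ω)
      rw [Real.dist_eq, Prod.dist_eq] at this
      simpa [sectionAt] using this)
    ‖φ‖ (fun a => hE.abs_apply_le fun ω => φ.norm_coe_le_norm (a, Y ω))

/-- `Y` is independent from `X` under `E`:
`E[φ(X, Y)] = E[ E[φ(a, Y)]|_{a = X} ]` for every bounded Lipschitz `φ`. -/
def IndependentFrom (hE : IsSublinearExpectation E) (Y : C(Ω, B)) (X : C(Ω, A)) : Prop :=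
  ∀ (φ : (A × B) →ᵇ ℝ) (hφ : ∃ K : ℝ≥0, LipschitzWith K φ),
    E (φ.compContinuous (X.prodMk Y)) = E ((partialExpectation hE Y φ hφ).compContinuous X)

end General

/-- The coordinate `ω ↦ ω n` on `ℝ^∞`. -/
def coord (n : ℕ) : C(ℕ → ℝ, ℝ) := ⟨fun ω => ω n, continuous_apply n⟩

/-- The vector `(ω 0, …, ω (n - 1))` of the coordinates that precede `coord n`. -/
def coordsBefore (n : ℕ) : C(ℕ → ℝ, Fin n → ℝ) :=
  ⟨fun ω i => ω i, continuous_pi fun i => continuous_apply (i : ℕ)⟩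

/-- The shift `θ(x₀, x₁, …) = (x₁, x₂, …)` on `ℝ^∞`. -/
def shift : C(ℕ → ℝ, ℕ → ℝ) :=
  ⟨fun ω n => ω (n + 1), continuous_pi fun n => continuous_apply (n + 1)⟩

/-- The coordinates are i.i.d. under `E`: all have the distribution of the first one, and each
coordinate is independent from the vector of the preceding ones. -/
structure CoordsIID {E : ((ℕ → ℝ) →ᵇ ℝ) → ℝ} (hE : IsSublinearExpectation E) : Prop where
  identDistrib : ∀ n : ℕ, IdenticallyDistributed E (coord n) (coord 0)
  indep : ∀ n : ℕ, 1 ≤ n → IndependentFrom hE (coord n) (coordsBefore n)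

end SublinearExp

end

/-! Conditioning is the engine. For Lipschitz functions of finitely many coordinates (`IsCylinder`),
iterated independence lets the first `m` coordinates be frozen and the later ones be replaced by a
fresh copy of the sequence (`CoordsIID.apply_eq_conditional`). Two consequences follow: `E` is
additive over disjoint consecutive blocks (`add_shift`), and `E[ψ (g ∘ θ^m - E g)] = 0` when `ψ ≥ 0`
depends on the first `m` coordinates (`mul_shift_sub`). Regularity carries results from cylinder
functions to `C_b` (`exists_cylinder`).

If `f` depends on at most `d` coordinates, its translates by multiples of `d` use disjoint blocks,
so `E^{(d)}[f] = E[f]` (`component_eq`). This gives the decomposition. It also gives the period: for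
`p < d`, the value at `f(ξ_p) - f(ξ_0)` is `E f + E (-f)`, which vanishes for all `f` only if `E` is
linear.

The limits exist by Fekete's lemma. They are suprema over dominated measures because `Θ` is compact
(tight by regularity), so that orbit averages of near-maximizers have a cluster point. The set
`Θ^{(d)}` consists of the `θ^d`-invariant members of `Θ` (`mem_dominated_component_iff`). For such
`P` and an invariant set `A`, `mul_shift_sub` yields `∫_A f dP ≤ P(A) E[f]`, so conditioning on `A`
stays in `Θ^{(d)}`; an extreme point therefore admits no nontrivial invariant set. -/

noncomputable section

namespace SublinearExp

/-! ### Elementary rules for sublinear expectations -/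

section General

variable {Ω : Type*} [TopologicalSpace Ω]

/-- The iterate `T^[k]` as a continuous map. -/
def iter (T : C(Ω, Ω)) (k : ℕ) : C(Ω, Ω) := ⟨T^[k], T.continuous.iterate k⟩

@[simp]
theorem iter_apply (T : C(Ω, Ω)) (k : ℕ) (ω : Ω) : iter T k ω = T^[k] ω := rfl

theorem koopman_iterate (T : C(Ω, Ω)) (k : ℕ) (f : Ω →ᵇ ℝ) :
    (koopman T)^[k] f = f.compContinuous (iter T k) := by
  ext ω
  exact koopman_iterate_apply T k f ω

variable [MeasurableSpace Ω] [OpensMeasurableSpace Ω] {E : (Ω →ᵇ ℝ) → ℝ}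

namespace IsSublinearExpectation

theorem mono (hE : IsSublinearExpectation E) {f g : Ω →ᵇ ℝ} (h : ∀ ω, f ω ≤ g ω) :
    E f ≤ E g := by
  simpa using hE.le_add_of_le (f := f) (g := g) (c := 0) (by simpa using h)

theorem add_const (hE : IsSublinearExpectation E) (f : Ω →ᵇ ℝ) (c : ℝ) :
    E (f + .const Ω c) = E f + c := by
  refine le_antisymm (hE.le_add_of_le fun ω => by simp) ?_
  have := hE.le_add_of_le (f := f) (g := f + .const Ω c) (c := -c) (fun ω => by simp)
  linarith

omit [OpensMeasurableSpace Ω] in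
theorem map_zero (hE : IsSublinearExpectation E) : E 0 = 0 := by
  simpa using hE.abs_apply_le (f := 0) (c := 0) (by simp)

theorem map_const (hE : IsSublinearExpectation E) (c : ℝ) : E (.const Ω c) = c := by
  simpa [hE.map_zero] using hE.add_const 0 c

theorem map_add_le (hE : IsSublinearExpectation E) (f g : Ω →ᵇ ℝ) :
    E (f + g) ≤ E f + E g := by
  refine (hE _).2 ?_
  rintro _ ⟨P, ⟨hP, hPE⟩, rfl⟩
  have : ∫ ω, (f + g) ω ∂P = ∫ ω, f ω ∂P + ∫ ω, g ω ∂P :=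
    integral_add (f.integrable P) (g.integrable P)
  simp only [this]
  exact add_le_add (hPE f) (hPE g)

omit [OpensMeasurableSpace Ω] in
theorem map_smul_le (hE : IsSublinearExpectation E) {c : ℝ} (hc : 0 ≤ c) (f : Ω →ᵇ ℝ) :
    E (c • f) ≤ c * E f := by
  refine (hE _).2 ?_
  rintro _ ⟨P, ⟨hP, hPE⟩, rfl⟩
  have : ∫ ω, (c • f) ω ∂P = c * ∫ ω, f ω ∂P := integral_const_mul c _
  simp only [this]
  exact mul_le_mul_of_nonneg_left (hPE f) hc

omit [OpensMeasurableSpace Ω] in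
theorem map_smul (hE : IsSublinearExpectation E) {c : ℝ} (hc : 0 ≤ c) (f : Ω →ᵇ ℝ) :
    E (c • f) = c * E f := by
  refine le_antisymm (hE.map_smul_le hc f) ?_
  rcases hc.eq_or_lt with rfl | hc'
  · simp [hE.map_zero]
  · have := hE.map_smul_le (inv_nonneg.2 hc) (c • f)
    rwa [smul_smul, inv_mul_cancel₀ hc'.ne', one_smul, le_inv_mul_iff₀ hc'] at this

theorem le_add_sub (hE : IsSublinearExpectation E) (f g : Ω →ᵇ ℝ) :
    E f ≤ E g + E (f - g) := by
  simpa using hE.map_add_le g (f - g)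

theorem zero_le_add_neg (hE : IsSublinearExpectation E) (f : Ω →ᵇ ℝ) : 0 ≤ E f + E (-f) := by
  simpa [hE.map_zero] using hE.map_add_le f (-f)

/-- Subadditivity already gives the reverse inequality, so `E` is odd; subadditivity at `-f`, `-g`
then becomes superadditivity. -/
theorem isLinearMap (hE : IsSublinearExpectation E) (h : ∀ f, E f + E (-f) ≤ 0) :
    IsLinearMap ℝ E := by
  have hneg : ∀ f, E (-f) = -E f := fun f => by
    linarith [h f, hE.zero_le_add_neg f]
  refine ⟨fun f g => le_antisymm (hE.map_add_le f g) ?_, fun c f => ?_⟩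
  · have := hE.map_add_le (-f) (-g)
    rw [← neg_add, hneg, hneg, hneg] at this
    linarith
  · rcases le_total 0 c with hc | hc
    · exact hE.map_smul hc f
    · have := hE.map_smul (neg_nonneg.2 hc) f
      have h2 : -c • f = -(c • f) := neg_smul c f
      rw [h2, hneg] at this
      simp only [smul_eq_mul]
      linarith

end IsSublinearExpectation

end General

/-! ### Functions of finitely many coordinates -/

/-- `f` is a Lipschitz function of the first `m` coordinates. -/
def IsCylinder (m : ℕ) (f : (ℕ → ℝ) →ᵇ ℝ) : Prop :=
  ∃ K : ℝ, 0 ≤ K ∧ ∀ ω ω', |f ω - f ω'| ≤ K * ∑ i ∈ Finset.range m, |ω i - ω' i|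

/-- The sequence `(a 0, …, a (m - 1), ω 0, ω 1, …)` as a function of `ω`. -/
def concat (m : ℕ) (a : ℕ → ℝ) : C(ℕ → ℝ, ℕ → ℝ) :=
  ⟨fun ω i => if i < m then a i else ω (i - m), continuous_pi fun i => by
    split_ifs
    exacts [continuous_const, continuous_apply _]⟩

theorem concat_of_lt {m i : ℕ} (h : i < m) (a ω : ℕ → ℝ) : concat m a ω i = a i := if_pos h

@[simp]
theorem concat_add (m i : ℕ) (a ω : ℕ → ℝ) : concat m a ω (m + i) = ω i := by
  simp [concat]

theorem concat_concat (m n : ℕ) (a b ω : ℕ → ℝ) :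
    concat (m + n) (concat m a b) ω = concat m a (concat n b ω) := by
  ext i
  rcases lt_or_ge i m with h | h
  · rw [concat_of_lt (by omega), concat_of_lt h, concat_of_lt h]
  · obtain ⟨j, rfl⟩ := Nat.exists_eq_add_of_le h
    rw [concat_add]
    rcases lt_or_ge j n with h | h
    · rw [concat_of_lt (by omega), concat_of_lt h, concat_add]
    · obtain ⟨l, rfl⟩ := Nat.exists_eq_add_of_le h
      rw [concat_add, ← add_assoc, concat_add]

@[simp]
theorem shift_iterate_apply (m : ℕ) (ω : ℕ → ℝ) (i : ℕ) : shift^[m] ω i = ω (m + i) := by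
  induction m generalizing ω with
  | zero => simp
  | succ m ih =>
    rw [Function.iterate_succ_apply, ih, add_right_comm]
    rfl

@[simp]
theorem shift_iterate_concat (m : ℕ) (a ω : ℕ → ℝ) : shift^[m] (concat m a ω) = ω := by
  ext i
  simp

@[simp]
theorem shift_concat_one (a ω : ℕ → ℝ) : shift (concat 1 a ω) = ω :=
  shift_iterate_concat 1 a ω

namespace IsCylinder

variable {m n : ℕ} {f g : (ℕ → ℝ) →ᵇ ℝ}

theorem mono (hf : IsCylinder m f) (h : m ≤ n) : IsCylinder n f := by
  obtain ⟨K, hK, hf⟩ := hf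
  refine ⟨K, hK, fun ω ω' => (hf ω ω').trans (mul_le_mul_of_nonneg_left ?_ hK)⟩
  exact Finset.sum_le_sum_of_subset_of_nonneg (by simpa using h) fun _ _ _ => abs_nonneg _

theorem congr (hf : IsCylinder m f) {ω ω' : ℕ → ℝ} (h : ∀ i < m, ω i = ω' i) :
    f ω = f ω' := by
  obtain ⟨K, -, hf⟩ := hf
  have := hf ω ω'
  rw [Finset.sum_eq_zero fun i hi => by simp [h i (Finset.mem_range.1 hi)], mul_zero] at this
  exact sub_eq_zero.1 (abs_nonpos_iff.1 this)

theorem add (hf : IsCylinder m f) (hg : IsCylinder m g) : IsCylinder m (f + g) := by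
  obtain ⟨K, hK, hf⟩ := hf
  obtain ⟨L, hL, hg⟩ := hg
  refine ⟨K + L, by positivity, fun ω ω' => ?_⟩
  rw [add_mul]
  refine le_trans ?_ (add_le_add (hf ω ω') (hg ω ω'))
  rw [BoundedContinuousFunction.add_apply, BoundedContinuousFunction.add_apply, add_sub_add_comm]
  exact abs_add_le _ _

theorem neg (hf : IsCylinder m f) : IsCylinder m (-f) := by
  obtain ⟨K, hK, hf⟩ := hf
  refine ⟨K, hK, fun ω ω' => ?_⟩
  rw [BoundedContinuousFunction.neg_apply, BoundedContinuousFunction.neg_apply, ← neg_sub',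
    abs_neg]
  exact hf ω ω'

theorem const (m : ℕ) (c : ℝ) : IsCylinder m (.const _ c) :=
  ⟨0, le_rfl, fun ω ω' => by simp⟩

theorem sub (hf : IsCylinder m f) (hg : IsCylinder m g) : IsCylinder m (f - g) := by
  rw [sub_eq_add_neg]
  exact hf.add hg.neg

theorem mul (hf : IsCylinder m f) (hg : IsCylinder m g) : IsCylinder m (f * g) := by
  obtain ⟨K, hK, hf⟩ := hf
  obtain ⟨L, hL, hg⟩ := hg
  refine ⟨‖g‖ * K + ‖f‖ * L, by positivity, fun ω ω' => ?_⟩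
  have h1 : (f * g) ω - (f * g) ω' = g ω * (f ω - f ω') + f ω' * (g ω - g ω') := by
    simp only [BoundedContinuousFunction.mul_apply]
    ring
  rw [h1, add_mul, mul_assoc, mul_assoc]
  refine (abs_add_le _ _).trans ?_
  rw [abs_mul, abs_mul]
  exact add_le_add
    (mul_le_mul (g.norm_coe_le_norm ω) (hf ω ω') (abs_nonneg _) (norm_nonneg _))
    (mul_le_mul (f.norm_coe_le_norm ω') (hg ω ω') (abs_nonneg _) (norm_nonneg _))

theorem sup_zero (hf : IsCylinder m f) : IsCylinder m (f ⊔ 0) := by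
  obtain ⟨K, hK, hf⟩ := hf
  refine ⟨K, hK, fun ω ω' => le_trans ?_ (hf ω ω')⟩
  simpa using abs_max_sub_max_le_abs (f ω) (f ω') 0

theorem comp_shift_pow (hf : IsCylinder n f) (m : ℕ) :
    IsCylinder (m + n) (f.compContinuous (iter shift m)) := by
  obtain ⟨K, hK, hf⟩ := hf
  refine ⟨K, hK, fun ω ω' => (hf _ _).trans (mul_le_mul_of_nonneg_left ?_ hK)⟩
  rw [Finset.sum_range_add]
  simp only [iter_apply, shift_iterate_apply]
  exact le_add_of_nonneg_left (Finset.sum_nonneg fun _ _ => abs_nonneg _)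

theorem comp_concat (hf : IsCylinder (m + n) f) (a : ℕ → ℝ) :
    IsCylinder n (f.compContinuous (concat m a)) := by
  obtain ⟨K, hK, hf⟩ := hf
  refine ⟨K, hK, fun ω ω' => (hf _ _).trans (mul_le_mul_of_nonneg_left ?_ hK)⟩
  rw [Finset.sum_range_add, Finset.sum_eq_zero fun i hi => ?_, zero_add]
  · simp
  · simp [concat_of_lt (Finset.mem_range.1 hi)]

theorem abs_concat_sub_le {K : ℝ} (hK : 0 ≤ K)
    (hf : ∀ ω ω', |f ω - f ω'| ≤ K * ∑ i ∈ Finset.range n, |ω i - ω' i|) (m : ℕ)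
    (a a' ω : ℕ → ℝ) :
    |f (concat m a ω) - f (concat m a' ω)| ≤ K * ∑ i ∈ Finset.range m, |a i - a' i| := by
  refine (hf _ _).trans (mul_le_mul_of_nonneg_left ?_ hK)
  have h1 : ∀ i, |concat m a ω i - concat m a' ω i| = if i < m then |a i - a' i| else 0 := by
    intro i
    simp only [concat, ContinuousMap.coe_mk]
    split_ifs <;> simp
  simp only [h1]
  rw [← Finset.sum_filter]
  exact Finset.sum_le_sum_of_subset_of_nonneg (fun i hi => by simp_all)
    fun _ _ _ => abs_nonneg _

end IsCylinder

/-! ### Conditioning on an initial block -/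

section Conditional

variable {E : ((ℕ → ℝ) →ᵇ ℝ) → ℝ} (hE : IsSublinearExpectation E)

/-- The function `a ↦ E[f(a 0, …, a (m - 1), ξ 0, ξ 1, …)]`. -/
def conditional (m : ℕ) {n : ℕ} (f : (ℕ → ℝ) →ᵇ ℝ) (hf : IsCylinder n f) : (ℕ → ℝ) →ᵇ ℝ :=
  BoundedContinuousFunction.ofNormedAddCommGroup (fun a => E (f.compContinuous (concat m a)))
    (by
      obtain ⟨K, hK, hf⟩ := hf
      refine continuous_iff_continuousAt.2 fun a => ?_
      refine tendsto_iff_dist_tendsto_zero.2 ?_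
      have h0 : Tendsto (fun b : ℕ → ℝ => K * ∑ i ∈ Finset.range m, |b i - a i|) (𝓝 a) (𝓝 0) := by
        have : Continuous fun b : ℕ → ℝ => K * ∑ i ∈ Finset.range m, |b i - a i| := by fun_prop
        simpa using this.tendsto a
      refine squeeze_zero (fun _ => dist_nonneg) (fun b => ?_) h0
      rw [Real.dist_eq]
      exact hE.abs_sub_le fun ω => IsCylinder.abs_concat_sub_le hK hf m b a ω)
    ‖f‖ (fun a => hE.abs_apply_le fun ω => f.norm_coe_le_norm _)

theorem conditional_apply (m : ℕ) {n : ℕ} (f : (ℕ → ℝ) →ᵇ ℝ) (hf : IsCylinder n f)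
    (a : ℕ → ℝ) : conditional hE m f hf a = E (f.compContinuous (concat m a)) := rfl

theorem isCylinder_conditional (m : ℕ) {n : ℕ} (f : (ℕ → ℝ) →ᵇ ℝ) (hf : IsCylinder n f) :
    IsCylinder m (conditional hE m f hf) := by
  obtain ⟨K, hK, hf'⟩ := id hf
  exact ⟨K, hK, fun a b => hE.abs_sub_le fun ω => IsCylinder.abs_concat_sub_le hK hf' m a b ω⟩

/-- The sequence `(x 0, …, x (n - 1), y, y, …)`. -/
def extend (n : ℕ) : C((Fin n → ℝ) × ℝ, ℕ → ℝ) :=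
  ⟨fun p i => if h : i < n then p.1 ⟨i, h⟩ else p.2, continuous_pi fun i => by
    split_ifs <;> fun_prop⟩

/-- Puts a cylinder function in the form required by `IndependentFrom`; each of the `n + 1`
coordinates contributes at most the sup distance. -/
theorem exists_lipschitzWith_extend {n : ℕ} {f : (ℕ → ℝ) →ᵇ ℝ} (hf : IsCylinder (n + 1) f) :
    ∃ K : ℝ≥0, LipschitzWith K (f.compContinuous (extend n)) := by
  obtain ⟨K, hK, hf⟩ := hf
  refine ⟨⟨K * (n + 1), by positivity⟩, LipschitzWith.of_dist_le_mul fun p q => ?_⟩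
  rw [Real.dist_eq]
  refine (hf _ _).trans ?_
  change _ ≤ K * (n + 1) * dist p q
  rw [mul_assoc]
  refine mul_le_mul_of_nonneg_left ?_ hK
  refine (Finset.sum_le_card_nsmul _ _ (dist p q) fun i _ => ?_).trans (by simp)
  rw [← Real.dist_eq, Prod.dist_eq]
  simp only [extend, ContinuousMap.coe_mk]
  split_ifs with h
  · exact (dist_le_pi_dist p.1 q.1 ⟨i, h⟩).trans (le_max_left _ _)
  · exact le_max_right _ _

variable {hE}

/-- Independence freezes the coordinates before `n`; identical distribution then replaces `ξ_n` by
`ξ_0`. -/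
theorem CoordsIID.apply_eq_conditional_one (hiid : CoordsIID hE) {n : ℕ} {f : (ℕ → ℝ) →ᵇ ℝ}
    (hf : IsCylinder (n + 1) f) : E f = E (conditional hE n f hf) := by
  rcases Nat.eq_zero_or_pos n with rfl | hn
  · have h0 : conditional hE 0 f hf = .const _ (E f) := by
      ext a
      rw [conditional_apply, BoundedContinuousFunction.const_apply]
      congr 1
    rw [h0, hE.map_const]
  have h1 : (f.compContinuous (extend n)).compContinuous
      ((coordsBefore n).prodMk (coord n)) = f := by
    ext ω
    refine hf.congr fun i hi => ?_
    rcases lt_or_ge i n with h | h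
    · exact dif_pos h
    · rw [show i = n by omega]
      exact dif_neg (lt_irrefl n)
  have hφ := exists_lipschitzWith_extend hf
  have h2 := hiid.indep n hn _ hφ
  rw [h1] at h2
  rw [h2]
  congr 1
  ext ω
  set a := coordsBefore n ω
  have h3 : ∃ K : ℝ≥0, LipschitzWith K
      ((f.compContinuous (extend n)).compContinuous ((ContinuousMap.const ℝ a).prodMk (.id ℝ))) := by
    obtain ⟨K, hK⟩ := hφ
    refine ⟨K, LipschitzWith.of_dist_le_mul fun y y' => ?_⟩
    simpa [Prod.dist_eq] using hK.dist_le_mul (a, y) (a, y')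
  change E (((f.compContinuous (extend n)).compContinuous
    ((ContinuousMap.const ℝ a).prodMk (.id ℝ))).compContinuous (coord n)) = _
  rw [hiid.identDistrib n _ h3, conditional_apply]
  congr 1
  ext ω'
  refine hf.congr fun i hi => ?_
  rcases lt_or_ge i n with h | h
  · rw [concat_of_lt h]
    exact dif_pos h
  · rw [show i = n + 0 by omega, concat_add]
    exact dif_neg (lt_irrefl n)

/-- The last coordinate is peeled off both outside and inside the conditional; the two results agree
by `concat_concat`. -/
theorem CoordsIID.apply_eq_conditional (hiid : CoordsIID hE) (m : ℕ) {n : ℕ} {f : (ℕ → ℝ) →ᵇ ℝ}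
    (hf : IsCylinder (m + n) f) : E f = E (conditional hE m f hf) := by
  induction n generalizing f with
  | zero =>
    congr 1
    ext a
    rw [conditional_apply]
    have : f.compContinuous (concat m a) = .const _ (f a) := by
      ext ω
      exact hf.congr fun i hi => concat_of_lt (by omega) _ _
    rw [this, hE.map_const]
  | succ n ih =>
    have hg := isCylinder_conditional hE (m + n) f hf
    rw [hiid.apply_eq_conditional_one (n := m + n) hf, ih hg]
    congr 1
    ext a
    rw [conditional_apply, conditional_apply, hiid.apply_eq_conditional_one (hf.comp_concat a)]
    congr 1
    ext ω
    rw [conditional_apply, BoundedContinuousFunction.compContinuous_apply, conditional_apply]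
    congr 1
    ext ω'
    simp [concat_concat]

theorem CoordsIID.koopman_of_isCylinder (hiid : CoordsIID hE) {n : ℕ} {f : (ℕ → ℝ) →ᵇ ℝ}
    (hf : IsCylinder n f) : E (koopman shift f) = E f := by
  have h : IsCylinder (1 + n) (f.compContinuous shift) := hf.comp_shift_pow 1
  rw [koopman, hiid.apply_eq_conditional 1 h]
  have : conditional hE 1 (f.compContinuous shift) h = .const _ (E f) := by
    ext a
    rw [conditional_apply, BoundedContinuousFunction.const_apply]
    congr 1
  rw [this, hE.map_const]

/-- Once the first `m` coordinates are frozen, `f` is a constant and the shifted `g` is just `g`. -/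
theorem CoordsIID.add_shift (hiid : CoordsIID hE) {m n : ℕ} {f g : (ℕ → ℝ) →ᵇ ℝ}
    (hf : IsCylinder m f) (hg : IsCylinder n g) :
    E (f + g.compContinuous (iter shift m)) = E f + E g := by
  have h := (hf.mono (Nat.le_add_right m n)).add (hg.comp_shift_pow m)
  rw [hiid.apply_eq_conditional m h, ← hE.add_const]
  congr 1
  ext a
  change E _ = f a + E g
  rw [add_comm (f a), ← hE.add_const]
  congr 1
  ext ω
  simp [add_comm, hf.congr fun i hi => concat_of_lt hi a ω]

/-- After freezing, `f` is a nonnegative scalar, so positive homogeneity pulls it out of the centred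
factor. -/
theorem CoordsIID.mul_shift_sub (hiid : CoordsIID hE) {m n : ℕ} {f g : (ℕ → ℝ) →ᵇ ℝ}
    (hf : IsCylinder m f) (hf0 : ∀ ω, 0 ≤ f ω) (hg : IsCylinder n g) :
    E (f * (g.compContinuous (iter shift m) - .const _ (E g))) = 0 := by
  have h := (hf.mono (Nat.le_add_right m n)).mul
    ((hg.comp_shift_pow m).sub (.const (m + n) (E g)))
  rw [hiid.apply_eq_conditional m h, ← hE.map_zero]
  congr 1
  ext a
  rw [conditional_apply]
  have : (f * (g.compContinuous (iter shift m) - .const _ (E g))).compContinuous (concat m a) =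
      f a • (g + .const _ (-E g)) := by
    ext ω
    simp [hf.congr fun i hi => concat_of_lt hi a ω, mul_add, sub_eq_add_neg]
  rw [this, hE.map_smul (hf0 a), hE.add_const]
  simp

/-- With no uncertainty in one coordinate, conditioning on all but one coordinate commutes with
negation, which drives the induction. -/
theorem CoordsIID.add_neg_of_isCylinder (hiid : CoordsIID hE)
    (h1 : ∀ f, IsCylinder 1 f → E f + E (-f) ≤ 0) {n : ℕ} {f : (ℕ → ℝ) →ᵇ ℝ}
    (hf : IsCylinder n f) : E f + E (-f) ≤ 0 := by
  induction n generalizing f with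
  | zero => exact h1 f (hf.mono (by simp))
  | succ n ih =>
    have h2 : conditional hE n (-f) hf.neg = -conditional hE n f hf := by
      ext a
      rw [BoundedContinuousFunction.neg_apply, conditional_apply, conditional_apply]
      have := hE.zero_le_add_neg (f.compContinuous (concat n a))
      exact eq_neg_of_add_eq_zero_right (le_antisymm (h1 _ (hf.comp_concat a)) this)
    rw [hiid.apply_eq_conditional_one hf, hiid.apply_eq_conditional_one hf.neg, h2]
    exact ih (isCylinder_conditional hE n f hf)

end Conditional

/-! ### Approximation by cylinder functions -/

theorem exists_lipschitz_approx {X : Type*} [PseudoMetricSpace X] (f : X →ᵇ ℝ) :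
    ∃ g : ℕ → X →ᵇ ℝ, (∀ k : ℕ, LipschitzWith k (g k)) ∧ Monotone g ∧
      (∀ k x, g k x ≤ f x) ∧ ∀ x, Tendsto (fun k => g k x) atTop (𝓝 (f x)) := by
  have hlow : ∀ y, -‖f‖ ≤ f y := fun y => (abs_le.1 (f.norm_coe_le_norm y)).1
  have hup : ∀ y, f y ≤ ‖f‖ := fun y => (abs_le.1 (f.norm_coe_le_norm y)).2
  have hlow' : ∀ (k : ℕ) (x y : X), -‖f‖ ≤ f y + k * dist x y := fun k x y =>
    (hlow y).trans (le_add_of_nonneg_right (by positivity))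
  have hbdd : ∀ (k : ℕ) (x : X), BddBelow (Set.range fun y => f y + k * dist x y) := fun k x =>
    ⟨-‖f‖, by rintro _ ⟨y, rfl⟩; exact hlow' k x y⟩
  -- The Lipschitz regularization of `f` by infimal convolution.
  set G : ℕ → X → ℝ := fun k x => ⨅ y, f y + k * dist x y with hG
  have hle : ∀ (k : ℕ) x y, G k x ≤ f y + k * dist x y := fun k x y => ciInf_le (hbdd k x) y
  have hlef : ∀ (k : ℕ) x, G k x ≤ f x := fun k x => by simpa using hle k x x
  have hge : ∀ (k : ℕ) x c, (∀ y, c ≤ f y + k * dist x y) → c ≤ G k x := fun k x c h =>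
    haveI : Nonempty X := ⟨x⟩
    le_ciInf h
  have hlip : ∀ k : ℕ, LipschitzWith k (G k) := fun k => by
    refine LipschitzWith.of_le_add_mul k fun x x' => ?_
    rw [← sub_le_iff_le_add]
    refine hge k x' _ fun y => ?_
    have h1 := hle k x y
    have h2 : (k : ℝ) * dist x y ≤ k * (dist x x' + dist x' y) :=
      mul_le_mul_of_nonneg_left (dist_triangle _ _ _) (Nat.cast_nonneg k)
    rw [NNReal.coe_natCast]
    linarith
  refine ⟨fun k => BoundedContinuousFunction.ofNormedAddCommGroup (G k) (hlip k).continuous ‖f‖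
    fun x => abs_le.2 ⟨hge k x _ (hlow' k x), (hlef k x).trans (hup x)⟩, hlip, ?_, hlef, ?_⟩
  · intro k l hkl x
    refine hge l x _ fun y => (hle k x y).trans ?_
    gcongr
  · intro x
    refine tendsto_order.2 ⟨fun a ha => ?_, fun a ha =>
      Eventually.of_forall fun k => (hlef k x).trans_lt ha⟩
    obtain ⟨b, hab, hb⟩ := exists_between ha
    obtain ⟨δ, hδ, hball⟩ := Metric.eventually_nhds_iff.1
      ((f.continuous.tendsto x).eventually (lt_mem_nhds hb))
    -- From here on, the penalty outside the `δ`-ball exceeds the oscillation of `f`.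
    obtain ⟨N, hN⟩ := exists_nat_ge (2 * ‖f‖ / δ)
    filter_upwards [eventually_ge_atTop N] with k hk
    refine hab.trans_le (hge k x b fun y => ?_)
    rcases lt_or_ge (dist y x) δ with hy | hy
    · exact (hball hy).le.trans (le_add_of_nonneg_right (by positivity))
    · have h1 : 2 * ‖f‖ ≤ k * dist x y := by
        rw [div_le_iff₀ hδ] at hN
        rw [dist_comm]
        exact hN.trans (mul_le_mul (by exact_mod_cast hk) hy hδ.le (Nat.cast_nonneg k))
      linarith [hlow y, hup x]

/-- The sequence `(ω 0, …, ω (m - 1), 0, 0, …)`. -/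
def truncate (m : ℕ) : C(ℕ → ℝ, ℕ → ℝ) :=
  ⟨fun ω i => if i < m then ω i else 0, continuous_pi fun i => by split_ifs <;> fun_prop⟩

theorem truncate_apply (m : ℕ) (ω : ℕ → ℝ) (i : ℕ) :
    truncate m ω i = if i < m then ω i else 0 := rfl

open scoped PiCountable in
theorem dist_truncate_truncate_le (m : ℕ) (ω ω' : ℕ → ℝ) :
    dist (truncate m ω) (truncate m ω') ≤ ∑ i ∈ Finset.range m, |ω i - ω' i| := by
  rw [PiCountable.dist_eq_tsum, tsum_eq_sum (s := Finset.range m)]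
  · refine Finset.sum_le_sum fun i hi => (min_le_right _ _).trans ?_
    rw [Finset.mem_range] at hi
    simp [truncate_apply, hi, Real.dist_eq]
  · intro i hi
    rw [Finset.mem_range] at hi
    simp [truncate_apply, hi]

open scoped PiCountable in
theorem dist_truncate_le (m : ℕ) (ω : ℕ → ℝ) : dist (truncate m ω) ω ≤ 2 * 2⁻¹ ^ m := by
  have hs := PiCountable.dist_summable (truncate m ω) ω
  rw [PiCountable.dist_eq_tsum, ← hs.sum_add_tsum_nat_add m, Finset.sum_eq_zero, zero_add]
  · have hg : HasSum (fun i : ℕ => (2⁻¹ : ℝ) ^ (i + m)) (2 * 2⁻¹ ^ m) := by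
      have := (hasSum_geometric_of_lt_one (r := (2⁻¹ : ℝ)) (by norm_num) (by norm_num)).mul_right
        (2⁻¹ ^ m)
      norm_num [pow_add] at this ⊢
      exact this
    rw [← hg.tsum_eq]
    refine ((summable_nat_add_iff m).2 hs).tsum_le_tsum (fun i => ?_) hg.summable
    exact min_le_left _ _
  · intro i hi
    rw [Finset.mem_range] at hi
    simp [truncate_apply, hi]

open scoped PiCountable in
-- Regularization costs `φ k`, which only decreases pointwise; truncation costs a uniform `ε`.
-- Keeping `φ` free of `ε` and `m` makes regularity applicable to it.
theorem exists_cylinder_approx (f : (ℕ → ℝ) →ᵇ ℝ) :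
    ∃ φ : ℕ → (ℕ → ℝ) →ᵇ ℝ, Antitone φ ∧ (∀ ω, Tendsto (fun k => φ k ω) atTop (𝓝 0)) ∧
      ∀ (k : ℕ) (ε : ℝ), 0 < ε → ∃ (m : ℕ) (g : (ℕ → ℝ) →ᵇ ℝ), IsCylinder m g ∧
        (∀ ω, g ω ≤ f ω) ∧ ∀ ω, f ω - g ω ≤ φ k ω + ε := by
  obtain ⟨h, hlip, hmono, hle, hlim⟩ := exists_lipschitz_approx f
  refine ⟨fun k => f - h k, fun k l hkl => sub_le_sub_left (hmono hkl) f, fun ω => ?_,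
    fun k ε hε => ?_⟩
  · simpa using (hlim ω).const_sub (f ω)
  · have h0 : Tendsto (fun m : ℕ => (k : ℝ) * (2 * 2⁻¹ ^ m)) atTop (𝓝 0) := by
      simpa using ((tendsto_pow_atTop_nhds_zero_of_lt_one (r := (2⁻¹ : ℝ)) (by norm_num)
        (by norm_num)).const_mul 2).const_mul (k : ℝ)
    obtain ⟨m, hm⟩ := (h0.eventually (gt_mem_nhds (half_pos hε))).exists
    have h1 : ∀ ω, |h k (truncate m ω) - h k ω| ≤ ε / 2 := fun ω => by
      rw [← Real.dist_eq]
      refine ((hlip k).dist_le_mul _ _).trans (le_trans ?_ hm.le)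
      exact mul_le_mul_of_nonneg_left (dist_truncate_le m ω) (Nat.cast_nonneg k)
    have h2 : IsCylinder m ((h k).compContinuous (truncate m)) := by
      refine ⟨k, Nat.cast_nonneg k, fun ω ω' => ?_⟩
      rw [← Real.dist_eq]
      refine ((hlip k).dist_le_mul _ _).trans ?_
      exact mul_le_mul_of_nonneg_left (dist_truncate_truncate_le m ω ω') (Nat.cast_nonneg k)
    refine ⟨m, _, h2.sub (.const m (ε / 2)), fun ω => ?_, fun ω => ?_⟩
    · have := (abs_le.1 (h1 ω)).2
      simp only [BoundedContinuousFunction.sub_apply, BoundedContinuousFunction.const_apply,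
        BoundedContinuousFunction.compContinuous_apply]
      linarith [hle k ω]
    · have := (abs_le.1 (h1 ω)).1
      simp only [BoundedContinuousFunction.sub_apply, BoundedContinuousFunction.const_apply,
        BoundedContinuousFunction.compContinuous_apply]
      linarith

/-! ### From cylinder functions to all of `C_b` -/

section

variable {E : ((ℕ → ℝ) →ᵇ ℝ) → ℝ} {hE : IsSublinearExpectation E}

/-- The shifted bound is included because it serves to prove invariance, which is not yet available.
-/
theorem IsSublinearExpectation.exists_cylinder (hE : IsSublinearExpectation E)
    (hreg : IsRegular E) (f : (ℕ → ℝ) →ᵇ ℝ) {ε : ℝ} (hε : 0 < ε) :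
    ∃ (m : ℕ) (g : (ℕ → ℝ) →ᵇ ℝ), IsCylinder m g ∧ (∀ ω, g ω ≤ f ω) ∧ E (f - g) ≤ ε ∧
      E (koopman shift (f - g)) ≤ ε := by
  obtain ⟨φ, hanti, hlim, happ⟩ := exists_cylinder_approx f
  have h1 := hreg φ hanti hlim
  have h2 := hreg (fun k => koopman shift (φ k)) (fun k l hkl ω => hanti hkl (shift ω))
    (fun ω => hlim (shift ω))
  obtain ⟨k, hk1, hk2⟩ := ((h1.eventually (gt_mem_nhds (half_pos hε))).and
    (h2.eventually (gt_mem_nhds (half_pos hε)))).exists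
  obtain ⟨m, g, hg, hgf, hfg⟩ := happ k (ε / 2) (half_pos hε)
  refine ⟨m, g, hg, hgf, ?_, ?_⟩
  · linarith [hE.le_add_of_le (f := f - g) (g := φ k) hfg]
  · linarith [hE.le_add_of_le (f := koopman shift (f - g)) (g := koopman shift (φ k))
      fun ω => hfg (shift ω)]

theorem CoordsIID.isInvariant (hiid : CoordsIID hE) (hreg : IsRegular E) :
    IsInvariant E shift := by
  intro f
  refine le_antisymm (le_of_forall_pos_le_add fun ε hε => ?_)
    (le_of_forall_pos_le_add fun ε hε => ?_)
  all_goals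
    obtain ⟨m, g, hg, hgf, h1, h2⟩ := hE.exists_cylinder hreg f hε
    have h3 := hiid.koopman_of_isCylinder hg
  · have h4 : E (koopman shift f) ≤ E (koopman shift g) + E (koopman shift (f - g)) :=
      hE.le_add_sub (koopman shift f) (koopman shift g)
    linarith [hE.mono hgf]
  · have h4 : E (koopman shift g) ≤ E (koopman shift f) := hE.mono fun ω => hgf (shift ω)
    linarith [hE.le_add_sub f g]

theorem CoordsIID.isLinearMap (hiid : CoordsIID hE) (hreg : IsRegular E)
    (h : ∀ f, IsCylinder 1 f → E f + E (-f) ≤ 0) : IsLinearMap ℝ E := by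
  refine hE.isLinearMap fun f => le_of_forall_pos_le_add fun ε hε => ?_
  obtain ⟨m, g, hg, hgf, h1, -⟩ := hE.exists_cylinder hreg f hε
  have h2 := hiid.add_neg_of_isCylinder h hg
  have h3 : E (-f) ≤ E (-g) := hE.mono fun ω => neg_le_neg (hgf ω)
  linarith [hE.le_add_sub f g]

end

/-! ### Components of an invariant sublinear expectation -/

section General

variable {Ω : Type*} [TopologicalSpace Ω] {E : (Ω →ᵇ ℝ) → ℝ} {T : C(Ω, Ω)}

theorem IsInvariant.iterate (hT : IsInvariant E T) (k : ℕ) (f : Ω →ᵇ ℝ) :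
    E ((koopman T)^[k] f) = E f := by
  induction k with
  | zero => rfl
  | succ k ih => rw [Function.iterate_succ_apply', hT, ih]

/-- The sum `∑_{k < n} f ∘ T^{kd}`. -/
def blockSum (T : C(Ω, Ω)) (d n : ℕ) (f : Ω →ᵇ ℝ) : Ω →ᵇ ℝ :=
  ∑ k ∈ Finset.range n, (koopman T)^[k * d] f

theorem blockSum_apply (T : C(Ω, Ω)) (d n : ℕ) (f : Ω →ᵇ ℝ) (ω : Ω) :
    blockSum T d n f ω = ∑ k ∈ Finset.range n, f (T^[k * d] ω) := by
  simp [blockSum, koopman_iterate_apply]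

theorem blockSum_add (T : C(Ω, Ω)) (d m n : ℕ) (f : Ω →ᵇ ℝ) :
    blockSum T d (m + n) f = blockSum T d m f + (koopman T)^[m * d] (blockSum T d n f) := by
  ext ω
  rw [BoundedContinuousFunction.add_apply, koopman_iterate_apply]
  simp only [blockSum_apply, Finset.sum_range_add, ← Function.iterate_add_apply]
  simp only [add_mul, add_comm]

theorem blockSum_map_add (T : C(Ω, Ω)) (d n : ℕ) (f g : Ω →ᵇ ℝ) :
    blockSum T d n (f + g) = blockSum T d n f + blockSum T d n g := by
  ext ω
  simp [blockSum_apply, Finset.sum_add_distrib]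

theorem blockSum_koopman (T : C(Ω, Ω)) (d n : ℕ) (f : Ω →ᵇ ℝ) :
    blockSum T d n (koopman T f) = koopman T (blockSum T d n f) := by
  ext ω
  have h : ∀ g : Ω →ᵇ ℝ, koopman T g ω = g (T ω) := fun _ => rfl
  rw [h]
  simp only [blockSum_apply, ← Function.iterate_succ_apply, Function.iterate_succ_apply']
  rfl

theorem blockSum_iterate_sub (T : C(Ω, Ω)) (d n : ℕ) (f : Ω →ᵇ ℝ) (ω : Ω) :
    blockSum T d n ((koopman T)^[d] f - f) ω = f (T^[n * d] ω) - f ω := by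
  rw [blockSum_apply]
  have : ∀ k, ((koopman T)^[d] f - f) (T^[k * d] ω) = f (T^[(k + 1) * d] ω) - f (T^[k * d] ω) := by
    intro k
    rw [BoundedContinuousFunction.sub_apply, koopman_iterate_apply, ← Function.iterate_add_apply,
      add_mul, one_mul, add_comm]
  simp only [this]
  rw [Finset.sum_range_sub (fun k => f (T^[k * d] ω))]
  simp

theorem component_eq_of_tendsto {d : ℕ} {f : Ω →ᵇ ℝ} {c : ℝ}
    (h : Tendsto (fun n : ℕ => (1 / (n : ℝ)) * E (blockSum T d n f)) atTop (𝓝 c)) :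
    component E T d f = c :=
  h.limUnder_eq

variable [MeasurableSpace Ω] [OpensMeasurableSpace Ω]

theorem tendsto_component (hE : IsSublinearExpectation E) (hT : IsInvariant E T) (d : ℕ)
    (f : Ω →ᵇ ℝ) :
    Tendsto (fun n : ℕ => (1 / (n : ℝ)) * E (blockSum T d n f)) atTop
      (𝓝 (component E T d f)) := by
  have hsub : Subadditive fun n => E (blockSum T d n f) := fun m n => by
    simp only [blockSum_add]
    refine (hE.map_add_le _ _).trans ?_
    rw [hT.iterate]
  have hbdd : BddBelow (Set.range fun n : ℕ => E (blockSum T d n f) / n) := by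
    refine ⟨-‖f‖, ?_⟩
    rintro _ ⟨n, rfl⟩
    have h1 : |E (blockSum T d n f)| ≤ n * ‖f‖ := hE.abs_apply_le fun ω => by
      rw [blockSum_apply]
      refine (Finset.abs_sum_le_sum_abs _ _).trans ?_
      simpa using Finset.sum_le_card_nsmul (Finset.range n) _ ‖f‖
        fun k _ => f.norm_coe_le_norm (T^[k * d] ω)
    rcases Nat.eq_zero_or_pos n with rfl | hn
    · simp
    · rw [le_div_iff₀ (by positivity)]
      linarith [(abs_le.1 h1).1]
  have h := hsub.tendsto_lim hbdd
  have h1 : ∀ n : ℕ, E (blockSum T d n f) / n = 1 / (n : ℝ) * E (blockSum T d n f) := fun n => by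
    ring
  simp only [h1] at h
  rwa [component_eq_of_tendsto h]

variable (hE : IsSublinearExpectation E) (hT : IsInvariant E T) (d : ℕ)
include hE hT

theorem apply_blockSum_le (n : ℕ) (f : Ω →ᵇ ℝ) : E (blockSum T d n f) ≤ n * E f := by
  induction n with
  | zero => simp [blockSum, hE.map_zero]
  | succ n ih =>
    rw [blockSum_add]
    refine (hE.map_add_le _ _).trans ?_
    rw [hT.iterate]
    have : blockSum T d 1 f = f := by simp [blockSum]
    rw [this]
    push_cast
    linarith

theorem component_le (f : Ω →ᵇ ℝ) : component E T d f ≤ E f := by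
  refine le_of_tendsto (tendsto_component hE hT d f) ?_
  filter_upwards [eventually_gt_atTop 0] with n hn
  rw [one_div, inv_mul_le_iff₀ (by positivity)]
  exact apply_blockSum_le hE hT d n f

theorem component_add_le (f g : Ω →ᵇ ℝ) :
    component E T d (f + g) ≤ component E T d f + component E T d g := by
  refine le_of_tendsto_of_tendsto' (tendsto_component hE hT d (f + g))
    ((tendsto_component hE hT d f).add (tendsto_component hE hT d g)) fun n => ?_
  rw [← mul_add, blockSum_map_add]
  exact mul_le_mul_of_nonneg_left (hE.map_add_le _ _) (by positivity)

theorem isInvariant_component : IsInvariant (component E T d) T := by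
  intro f
  refine component_eq_of_tendsto ?_
  simp only [blockSum_koopman]
  simp only [hT _]
  exact tendsto_component hE hT d f

omit hT [OpensMeasurableSpace Ω] in
theorem component_iterate_sub (f : Ω →ᵇ ℝ) :
    component E T d ((koopman T)^[d] f - f) = 0 := by
  refine component_eq_of_tendsto ?_
  have h0 : Tendsto (fun n : ℕ => (1 / (n : ℝ)) * (2 * ‖f‖)) atTop (𝓝 0) := by
    simpa using (tendsto_one_div_atTop_nhds_zero_nat (𝕜 := ℝ)).mul_const (2 * ‖f‖)
  refine squeeze_zero_norm (fun n => ?_) h0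
  rw [norm_mul, Real.norm_of_nonneg (by positivity : (0 : ℝ) ≤ 1 / n)]
  refine mul_le_mul_of_nonneg_left (hE.abs_apply_le fun ω => ?_) (by positivity)
  rw [blockSum_iterate_sub, two_mul]
  exact (abs_sub _ _).trans (add_le_add (f.norm_coe_le_norm _) (f.norm_coe_le_norm _))

theorem integral_le_component_of_measurePreserving [BorelSpace Ω] {P : Measure Ω}
    (hP : P ∈ dominated E) (hPT : MeasurePreserving T^[d] P P) (f : Ω →ᵇ ℝ) :
    ∫ ω, f ω ∂P ≤ component E T d f := by
  have := hP.1
  refine ge_of_tendsto (tendsto_component hE hT d f) ?_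
  filter_upwards [eventually_gt_atTop 0] with n hn
  have h : ∫ ω, blockSum T d n f ω ∂P = n * ∫ ω, f ω ∂P := by
    simp only [blockSum, BoundedContinuousFunction.coe_sum, Finset.sum_apply]
    rw [integral_finsetSum _ fun k _ => BoundedContinuousFunction.integrable P _]
    have h1 : ∀ k, ∫ ω, (koopman T)^[k * d] f ω ∂P = ∫ ω, f ω ∂P := fun k => by
      simp only [koopman_iterate_apply]
      have h2 : MeasurePreserving T^[k * d] P P := by
        rw [mul_comm, Function.iterate_mul]
        exact hPT.iterate k
      rw [← integral_map h2.aemeasurable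
        (f.continuous.aestronglyMeasurable), h2.map_eq]
    simp [h1]
  rw [one_div, le_inv_mul_iff₀ (by positivity), ← h]
  exact hP.2 _

/-- The component vanishes on coboundaries `f ∘ T^d - f`; testing with `f` and `-f` forces
invariance. Conversely, an invariant `P` does not see the averaging. -/
theorem mem_dominated_component_iff [BorelSpace Ω] [HasOuterApproxClosed Ω] {P : Measure Ω} :
    P ∈ dominated (component E T d) ↔ P ∈ dominated E ∧ MeasurePreserving T^[d] P P := by
  constructor
  · rintro ⟨hP, hle⟩
    refine ⟨⟨hP, fun f => (hle f).trans (component_le hE hT d f)⟩, ?_⟩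
    have hc : Continuous T^[d] := T.continuous.iterate d
    have h1 : ∀ f : Ω →ᵇ ℝ, ∫ ω, f (T^[d] ω) ∂P ≤ ∫ ω, f ω ∂P := fun f => by
      have h2 := hle ((koopman T)^[d] f - f)
      rw [component_iterate_sub hE d] at h2
      simp only [BoundedContinuousFunction.sub_apply] at h2
      rw [integral_sub (BoundedContinuousFunction.integrable P _) (f.integrable P)] at h2
      simp only [koopman_iterate_apply] at h2
      linarith
    have h3 : ∀ f : Ω →ᵇ ℝ, ∫ ω, f (T^[d] ω) ∂P = ∫ ω, f ω ∂P := fun f => by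
      refine le_antisymm (h1 f) ?_
      have := h1 (-f)
      simp only [BoundedContinuousFunction.neg_apply, integral_neg] at this
      linarith
    refine ⟨hc.measurable, ?_⟩
    have := Measure.isProbabilityMeasure_map (μ := P) hc.aemeasurable
    refine ext_of_forall_integral_eq_of_IsFiniteMeasure fun f => ?_
    rw [integral_map hc.aemeasurable f.continuous.aestronglyMeasurable, h3]
  · rintro ⟨hP, hPT⟩
    exact ⟨hP.1, integral_le_component_of_measurePreserving hE hT d hP hPT⟩

end General

/-! ### Periodic decomposition and periods -/

section Shift

variable {E : ((ℕ → ℝ) →ᵇ ℝ) → ℝ} {hE : IsSublinearExpectation E}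

theorem CoordsIID.isCylinder_blockSum (hiid : CoordsIID hE) {m d : ℕ} (hmd : m ≤ d)
    {f : (ℕ → ℝ) →ᵇ ℝ} (hf : IsCylinder m f) (n : ℕ) :
    IsCylinder (n * d) (blockSum shift d n f) ∧ E (blockSum shift d n f) = n * E f := by
  induction n with
  | zero =>
    refine ⟨?_, by simp [blockSum, hE.map_zero]⟩
    rw [zero_mul]
    exact IsCylinder.const 0 0
  | succ n ih =>
    -- The first block is split off, not the last, to match the form of `add_shift`.
    have h1 : blockSum shift d (n + 1) f =
        f + (blockSum shift d n f).compContinuous (iter shift d) := by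
      rw [add_comm n, blockSum_add, koopman_iterate]
      simp [blockSum]
    refine ⟨?_, ?_⟩
    · rw [h1, add_mul, one_mul, add_comm (n * d)]
      exact (hf.mono (by omega)).add (ih.1.comp_shift_pow d)
    · rw [h1, hiid.add_shift (hf.mono hmd) ih.1, ih.2]
      push_cast
      ring

theorem CoordsIID.component_eq (hiid : CoordsIID hE) {m d : ℕ} (hmd : m ≤ d)
    {f : (ℕ → ℝ) →ᵇ ℝ} (hf : IsCylinder m f) : component E shift d f = E f := by
  refine component_eq_of_tendsto (tendsto_const_nhds.congr' ?_)
  filter_upwards [eventually_gt_atTop 0] with n hn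
  rw [(hiid.isCylinder_blockSum hmd hf n).2]
  field_simp

theorem CoordsIID.hasPeriodicDecomposition (hiid : CoordsIID hE) (hreg : IsRegular E) :
    HasPeriodicDecomposition E shift := by
  have hT := hiid.isInvariant hreg
  refine ⟨hT, fun f => ⟨?_, fun c hc => le_of_forall_pos_le_add fun ε hε => ?_⟩⟩
  · rintro _ ⟨d, -, rfl⟩
    exact component_le hE hT d f
  · obtain ⟨m, g, hg, hgf, h1, -⟩ := hE.exists_cylinder hreg f (half_pos hε)
    -- Any period `d ≥ m` would serve; `m + 1` is also positive.
    have h2 := hc ⟨m + 1, by omega, rfl⟩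
    have h3 := hiid.component_eq (Nat.le_succ m) hg
    have h4 := component_add_le hE hT (m + 1) f (g - f)
    have h5 := component_le hE hT (m + 1) (g - f)
    have h6 : E (g - f) ≤ 0 := by
      rw [← hE.map_zero]
      exact hE.mono fun ω => sub_nonpos.2 (hgf ω)
    rw [add_sub_cancel, h3] at h4
    linarith [hE.le_add_sub f g]

theorem CoordsIID.hasPeriod (hiid : CoordsIID hE) (hreg : IsRegular E)
    (hlin : ¬ IsLinearMap ℝ E) {d : ℕ} (hd : 1 ≤ d) :
    HasPeriod (component E shift d) shift d := by
  have hT := hiid.isInvariant hreg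
  refine ⟨⟨hd, component_iterate_sub hE d⟩, fun p hp => ?_⟩
  obtain ⟨hp1, hp⟩ := hp
  by_contra! hpd
  refine hlin (hiid.isLinearMap hreg fun f hf => ?_)
  have h1 : (koopman shift)^[p] f - f = -f + f.compContinuous (iter shift p) := by
    rw [koopman_iterate, sub_eq_neg_add]
  have h2 := hp f
  have hcyl : IsCylinder (p + 1) (-f + f.compContinuous (iter shift p)) :=
    (hf.neg.mono (by omega)).add (hf.comp_shift_pow p)
  rw [h1, hiid.component_eq hpd hcyl, hiid.add_shift (hf.neg.mono hp1) hf] at h2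
  linarith

end Shift

/-! ### Components as suprema over measures -/

section General

variable {Ω : Type*} [TopologicalSpace Ω] [MeasurableSpace Ω] [BorelSpace Ω]
  {E : (Ω →ᵇ ℝ) → ℝ} {T : C(Ω, Ω)}

theorem isClosed_dominated (E : (Ω →ᵇ ℝ) → ℝ) :
    IsClosed {μ : ProbabilityMeasure Ω | (μ : Measure Ω) ∈ dominated E} := by
  have : {μ : ProbabilityMeasure Ω | (μ : Measure Ω) ∈ dominated E} =
      ⋂ f : Ω →ᵇ ℝ, {μ : ProbabilityMeasure Ω | ∫ ω, f ω ∂(μ : Measure Ω) ≤ E f} := by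
    ext μ
    simpa [dominated] using fun _ => μ.2
  rw [this]
  exact isClosed_iInter fun f => isClosed_le
    (ProbabilityMeasure.continuous_integral_boundedContinuousFunction f) continuous_const

/-- The average `(1/n) ∑_{k < n} P ∘ T^{-kd}`. -/
def average (T : C(Ω, Ω)) (d n : ℕ) (P : Measure Ω) : Measure Ω :=
  (n : ℝ≥0∞)⁻¹ • ∑ k ∈ Finset.range n, P.map T^[k * d]

theorem isProbabilityMeasure_average (T : C(Ω, Ω)) (d : ℕ) {n : ℕ} (hn : n ≠ 0) (P : Measure Ω)
    [IsProbabilityMeasure P] : IsProbabilityMeasure (average T d n P) := by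
  refine ⟨?_⟩
  have h : ∀ k, P.map T^[k * d] Set.univ = 1 := fun k =>
    (Measure.isProbabilityMeasure_map (T.continuous.iterate _).aemeasurable).measure_univ
  simp only [average, Measure.smul_apply, Measure.coe_finsetSum, Finset.sum_apply, h]
  simp [ENNReal.inv_mul_cancel, hn]

theorem integral_average (T : C(Ω, Ω)) (d n : ℕ) (P : Measure Ω) [IsProbabilityMeasure P]
    (f : Ω →ᵇ ℝ) :
    ∫ ω, f ω ∂(average T d n P) = (1 / (n : ℝ)) * ∫ ω, blockSum T d n f ω ∂P := by
  have hc : ∀ k, Continuous T^[k * d] := fun k => T.continuous.iterate _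
  have hP : ∀ k, IsProbabilityMeasure (P.map T^[k * d]) := fun k =>
    Measure.isProbabilityMeasure_map (hc k).aemeasurable
  rw [average, integral_smul_measure, integral_finsetSum_measure fun k _ => f.integrable _]
  simp only [blockSum, BoundedContinuousFunction.coe_sum, Finset.sum_apply]
  rw [integral_finsetSum _ fun k _ => BoundedContinuousFunction.integrable P _]
  simp only [koopman_iterate_apply,
    integral_map (hc _).aemeasurable f.continuous.aestronglyMeasurable]
  simp

/-- A Krylov–Bogoliubov argument: a cluster point of the averaged near-maximizers is dominated by
the component and attains its value at `f`. -/
theorem isSublinearExpectation_component [T2Space Ω] (hE : IsSublinearExpectation E)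
    (hT : IsInvariant E T) (htight : IsTightMeasureSet (dominated E)) (d : ℕ) :
    IsSublinearExpectation (component E T d) := by
  intro f
  refine ⟨?_, fun c hc => ?_⟩
  · rintro _ ⟨P, hP, rfl⟩
    exact hP.2 f
  have hcomp : IsCompact {μ : ProbabilityMeasure Ω | (μ : Measure Ω) ∈ dominated E} := by
    rw [← (isClosed_dominated E).closure_eq]
    refine isCompact_closure_of_isTightMeasureSet (htight.subset ?_)
    rintro _ ⟨μ, hμ, rfl⟩
    exact hμ
  -- A slack of `1` is harmless, since it is later divided by `n + 1`.
  have hexists : ∀ n : ℕ, ∃ P ∈ dominated E,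
      E (blockSum T d (n + 1) f) - 1 < ∫ ω, blockSum T d (n + 1) f ω ∂P := fun n => by
    obtain ⟨_, ⟨P, hP, rfl⟩, hlt, -⟩ := (hE (blockSum T d (n + 1) f)).exists_between
      (sub_one_lt _)
    exact ⟨P, hP, hlt⟩
  choose P hP hlt using hexists
  have hprob : ∀ n, IsProbabilityMeasure (P n) := fun n => (hP n).1
  let Q : ℕ → ProbabilityMeasure Ω := fun n =>
    ⟨average T d (n + 1) (P n), isProbabilityMeasure_average T d n.succ_ne_zero _⟩
  have hQ : ∀ n (g : Ω →ᵇ ℝ), ∫ ω, g ω ∂(Q n : Measure Ω) =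
      (1 / ((n + 1 : ℕ) : ℝ)) * ∫ ω, blockSum T d (n + 1) g ω ∂(P n) := fun n g =>
    integral_average T d (n + 1) (P n) g
  have hQle : ∀ n (g : Ω →ᵇ ℝ), ∫ ω, g ω ∂(Q n : Measure Ω) ≤
      (1 / ((n + 1 : ℕ) : ℝ)) * E (blockSum T d (n + 1) g) := fun n g => by
    rw [hQ]
    exact mul_le_mul_of_nonneg_left ((hP n).2 _) (by positivity)
  have hQmem : ∀ n, (Q n : Measure Ω) ∈ dominated E := fun n => by
    refine ⟨(Q n).2, fun g => (hQle n g).trans ?_⟩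
    rw [one_div, inv_mul_le_iff₀ (by positivity)]
    exact apply_blockSum_le hE hT d (n + 1) g
  obtain ⟨R, -, hR⟩ := hcomp.ultrafilter_le_nhds ((hyperfilter ℕ).map Q) (by
    rw [le_principal_iff]
    exact Ultrafilter.mem_map.2 (univ_mem' hQmem))
  have hlim : ∀ g : Ω →ᵇ ℝ, Tendsto (fun n => ∫ ω, g ω ∂(Q n : Measure Ω)) (hyperfilter ℕ)
      (𝓝 (∫ ω, g ω ∂(R : Measure Ω))) :=
    ProbabilityMeasure.tendsto_iff_forall_integral_tendsto.1 hR
  have hE' : ∀ g, Tendsto (fun n : ℕ => (1 / ((n + 1 : ℕ) : ℝ)) * E (blockSum T d (n + 1) g))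
      (hyperfilter ℕ) (𝓝 (component E T d g)) := fun g =>
    ((tendsto_component hE hT d g).comp (tendsto_add_atTop_nat 1)).mono_left
      Nat.hyperfilter_le_atTop
  refine le_trans ?_ (hc ⟨R, ⟨R.2, fun g =>
    le_of_tendsto_of_tendsto' (hlim g) (hE' g) fun n => hQle n g⟩, rfl⟩)
  have h1 : Tendsto (fun n : ℕ => 1 / ((n + 1 : ℕ) : ℝ)) (hyperfilter ℕ) (𝓝 0) :=
    (tendsto_one_div_atTop_nhds_zero_nat.comp (tendsto_add_atTop_nat 1)).mono_left
      Nat.hyperfilter_le_atTop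
  have h2 := (hE' f).sub h1
  rw [sub_zero] at h2
  refine le_of_tendsto_of_tendsto' h2 (hlim f) fun n => ?_
  rw [hQ, ← mul_sub_one]
  exact mul_le_mul_of_nonneg_left (hlt n).le (by positivity)

end General

/-! ### Tightness and ergodicity -/

section Shift

variable {E : ((ℕ → ℝ) →ᵇ ℝ) → ℝ} {hE : IsSublinearExpectation E}

/-- A bounded continuous function between the indicators of `|ω i| ≥ k + 1` and `|ω i| ≥ k`. -/
def tailIndicator (i k : ℕ) : (ℕ → ℝ) →ᵇ ℝ :=
  BoundedContinuousFunction.ofNormedAddCommGroup (fun ω => min 1 (max 0 (|ω i| - k)))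
    (by fun_prop) 1 fun ω => by
      rw [Real.norm_of_nonneg (le_min zero_le_one (le_max_left _ _))]
      exact min_le_left _ _

theorem tailIndicator_apply (i k : ℕ) (ω : ℕ → ℝ) :
    tailIndicator i k ω = min 1 (max 0 (|ω i| - k)) := rfl

theorem IsRegular.exists_measure_le (hreg : IsRegular E) (i : ℕ) {ε : ℝ≥0} (hε : 0 < ε) :
    ∃ r : ℝ, ∀ P ∈ dominated E, P {ω | r < |ω i|} ≤ ε := by
  have h : Tendsto (fun k => E (tailIndicator i k)) atTop (𝓝 0) := by
    refine hreg _ (fun k l hkl ω => ?_) fun ω => ?_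
    · change tailIndicator i l ω ≤ tailIndicator i k ω
      simp only [tailIndicator_apply]
      gcongr
    · refine tendsto_const_nhds.congr' ?_
      obtain ⟨N, hN⟩ := exists_nat_ge |ω i|
      filter_upwards [eventually_ge_atTop N] with k hk
      have : |ω i| ≤ k := hN.trans (by exact_mod_cast hk)
      rw [tailIndicator_apply, max_eq_left (by linarith), min_eq_right zero_le_one]
  obtain ⟨k, hk⟩ := (h.eventually (gt_mem_nhds (show (0 : ℝ) < ε from hε))).exists
  refine ⟨k + 1, fun P hP => ?_⟩
  have := hP.1
  have hle : {ω : ℕ → ℝ | (k : ℝ) + 1 < |ω i|} ⊆ {ω | 1 ≤ tailIndicator i k ω} := fun ω hω => by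
    rw [Set.mem_ofPred_eq] at hω ⊢
    rw [tailIndicator_apply]
    exact le_min le_rfl (le_max_of_le_right (by linarith))
  have h1 := mul_meas_ge_le_integral_of_nonneg (μ := P) (f := tailIndicator i k)
    (Eventually.of_forall fun ω => le_min zero_le_one (le_max_left _ _))
    ((tailIndicator i k).integrable P) 1
  rw [one_mul] at h1
  refine (measure_mono hle).trans ?_
  rw [← ENNReal.ofReal_coe_nnreal, ← ofReal_measureReal]
  exact ENNReal.ofReal_le_ofReal (h1.trans ((hP.2 _).trans hk.le))

theorem IsRegular.isTightMeasureSet (hreg : IsRegular E) : IsTightMeasureSet (dominated E) := by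
  rw [isTightMeasureSet_iff_exists_isCompact_measure_compl_le]
  intro ε hε
  obtain ⟨δ, hδ, hsum⟩ := ENNReal.exists_pos_sum_of_countable hε.ne' ℕ
  choose r hr using fun i => hreg.exists_measure_le i (hδ i)
  refine ⟨Set.univ.pi fun i => Set.Icc (-r i) (r i), isCompact_univ_pi fun i => isCompact_Icc,
    fun P hP => ?_⟩
  have hsub : (Set.univ.pi fun i => Set.Icc (-r i) (r i))ᶜ ⊆ ⋃ i, {ω : ℕ → ℝ | r i < |ω i|} := by
    intro ω hω
    by_contra h
    refine hω fun i _ => abs_le.1 ?_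
    simp only [Set.mem_iUnion, Set.mem_ofPred_eq, not_exists, not_lt] at h
    exact h i
  calc P _ ≤ P (⋃ i, {ω : ℕ → ℝ | r i < |ω i|}) := measure_mono hsub
    _ ≤ ∑' i, P {ω : ℕ → ℝ | r i < |ω i|} := measure_iUnion_le _
    _ ≤ ∑' i, (δ i : ℝ≥0∞) := ENNReal.tsum_le_tsum fun i => hr i P hP
    _ ≤ ε := hsum.le

/-- The positive part is taken so that the approximant can be the factor `f` in `mul_shift_sub`; it
does not increase the error, as the indicator is nonnegative. -/
theorem exists_cylinder_integral_le (hE : IsSublinearExpectation E) (hreg : IsRegular E)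
    {P : Measure (ℕ → ℝ)} (hP : P ∈ dominated E) {A : Set (ℕ → ℝ)} (hA : MeasurableSet A)
    {ε : ℝ} (hε : 0 < ε) :
    ∃ (m : ℕ) (ψ : (ℕ → ℝ) →ᵇ ℝ), IsCylinder m ψ ∧ (∀ ω, 0 ≤ ψ ω) ∧
      ∫ ω, |A.indicator 1 ω - ψ ω| ∂P ≤ ε := by
  have := hP.1
  have hint : Integrable (A.indicator (1 : (ℕ → ℝ) → ℝ)) P :=
    (integrable_const (1 : ℝ)).indicator hA
  obtain ⟨ψ₀, hψ₀, -⟩ := hint.exists_boundedContinuous_integral_sub_le (half_pos hε)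
  obtain ⟨m, ψ₁, hcyl, hle, hψ₁, -⟩ := hE.exists_cylinder hreg ψ₀ (half_pos hε)
  refine ⟨m, ψ₁ ⊔ 0, hcyl.sup_zero, fun ω => le_sup_right, ?_⟩
  have h1 : ∀ ω, |A.indicator (1 : (ℕ → ℝ) → ℝ) ω - (ψ₁ ⊔ 0) ω| ≤
      ‖A.indicator (1 : (ℕ → ℝ) → ℝ) ω - ψ₀ ω‖ + (ψ₀ - ψ₁) ω := fun ω => by
    have h2 : (0 : ℝ) ≤ A.indicator 1 ω := Set.indicator_nonneg (fun _ _ => zero_le_one) ω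
    have h3 := abs_max_sub_max_le_abs (A.indicator 1 ω) (ψ₁ ω) 0
    rw [max_eq_left h2] at h3
    refine h3.trans ((abs_sub_le _ (ψ₀ ω) _).trans_eq ?_)
    rw [abs_of_nonneg (sub_nonneg.2 (hle ω))]
    rfl
  calc _ ≤ ∫ ω, (‖A.indicator (1 : (ℕ → ℝ) → ℝ) ω - ψ₀ ω‖ + (ψ₀ - ψ₁) ω) ∂P :=
        integral_mono (hint.sub (BoundedContinuousFunction.integrable P _)).abs
          ((hint.sub (ψ₀.integrable P)).norm.add (BoundedContinuousFunction.integrable P _)) h1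
    _ = ∫ ω, ‖A.indicator (1 : (ℕ → ℝ) → ℝ) ω - ψ₀ ω‖ ∂P + ∫ ω, (ψ₀ - ψ₁) ω ∂P :=
        integral_add (hint.sub (ψ₀.integrable P)).norm (BoundedContinuousFunction.integrable P _)
    _ ≤ ε := by linarith [hP.2 (ψ₀ - ψ₁)]

/-- Invariance moves `f` beyond the coordinates of a cylinder approximation `ψ` of the indicator of
`A`; there `E[ψ (f ∘ θ^{dm} - E f)] = 0`. -/
theorem CoordsIID.setIntegral_le_of_isCylinder (hiid : CoordsIID hE) (hreg : IsRegular E) {d : ℕ}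
    (hd : 1 ≤ d) {P : Measure (ℕ → ℝ)} (hP : P ∈ dominated E)
    (hPT : MeasurePreserving shift^[d] P P) {A : Set (ℕ → ℝ)} (hA : MeasurableSet A)
    (hAT : shift^[d] ⁻¹' A = A) {n : ℕ} {f : (ℕ → ℝ) →ᵇ ℝ} (hf : IsCylinder n f) :
    ∫ ω in A, f ω ∂P ≤ P.real A * E f := by
  have := hP.1
  have hEf : |E f| ≤ ‖f‖ := hE.abs_apply_le f.norm_coe_le_norm
  refine le_of_forall_pos_le_add fun ε hε => ?_
  -- The centred function is bounded by `2 * ‖f‖`; the `+ 1` covers `f = 0`.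
  have hδ : 0 < ε / (2 * ‖f‖ + 1) := by positivity
  obtain ⟨m, ψ, hψ, hψ0, hψA⟩ := exists_cylinder_integral_le hE hreg hP hA hδ
  -- The shift must be a multiple of `d` to preserve `P` and `A`.
  have hψ' : IsCylinder (d * m) ψ := hψ.mono (Nat.le_mul_of_pos_left m hd)
  have hT : MeasurePreserving shift^[d * m] P P := by
    rw [Function.iterate_mul]
    exact hPT.iterate m
  have hAT' : shift^[d * m] ⁻¹' A = A := by
    rw [Function.iterate_mul, Set.preimage_iterate_eq]
    exact Function.iterate_fixed hAT m
  set g : (ℕ → ℝ) →ᵇ ℝ := f.compContinuous (iter shift (d * m)) - .const _ (E f) with hg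
  have hgle : ∀ ω, |g ω| ≤ 2 * ‖f‖ := fun ω => by
    rw [two_mul]
    exact (abs_sub _ _).trans (add_le_add (f.norm_coe_le_norm _) hEf)
  have h1 : ∫ ω in A, f ω ∂P = ∫ ω in A, f (shift^[d * m] ω) ∂P := by
    have h := setIntegral_map (μ := P) (s := A) hA (f := f) (g := shift^[d * m])
      f.continuous.aestronglyMeasurable hT.aemeasurable
    rwa [hT.map_eq, hAT'] at h
  have h2 : ∫ ω in A, f ω ∂P - P.real A * E f = ∫ ω in A, g ω ∂P := by
    rw [h1]
    simp only [hg, BoundedContinuousFunction.sub_apply, BoundedContinuousFunction.const_apply]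
    rw [integral_sub (BoundedContinuousFunction.integrable _ _) (integrable_const _)]
    simp
  have hint : Integrable (fun ω => |A.indicator (1 : (ℕ → ℝ) → ℝ) ω - ψ ω|) P :=
    (((integrable_const (1 : ℝ)).indicator hA).sub (ψ.integrable P)).abs
  have h3 : ∫ ω in A, g ω ∂P ≤
      ∫ ω, ((ψ * g) ω + 2 * ‖f‖ * |A.indicator (1 : (ℕ → ℝ) → ℝ) ω - ψ ω|) ∂P := by
    rw [← integral_indicator hA]
    refine integral_mono ((g.integrable P).indicator hA)
      ((BoundedContinuousFunction.integrable P _).add (hint.const_mul _)) fun ω => ?_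
    have h4 : A.indicator g ω = (ψ * g) ω + (A.indicator (1 : (ℕ → ℝ) → ℝ) ω - ψ ω) * g ω := by
      rw [BoundedContinuousFunction.mul_apply, ← add_mul, add_sub_cancel]
      by_cases h : ω ∈ A <;> simp [h]
    rw [h4]
    refine add_le_add_right ((le_abs_self _).trans ?_) _
    rw [abs_mul, mul_comm]
    exact mul_le_mul_of_nonneg_right (hgle ω) (abs_nonneg _)
  have h5 : ∫ ω, (ψ * g) ω ∂P ≤ 0 :=
    (hP.2 _).trans (hiid.mul_shift_sub hψ' hψ0 hf).le
  rw [integral_add (BoundedContinuousFunction.integrable P _) (hint.const_mul _),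
    integral_const_mul] at h3
  have h6 : 2 * ‖f‖ * ∫ ω, |A.indicator (1 : (ℕ → ℝ) → ℝ) ω - ψ ω| ∂P ≤ ε := by
    rw [le_div_iff₀ (by positivity)] at hψA
    have : 0 ≤ ∫ ω, |A.indicator (1 : (ℕ → ℝ) → ℝ) ω - ψ ω| ∂P :=
      integral_nonneg fun _ => abs_nonneg _
    linarith
  linarith

theorem CoordsIID.setIntegral_le (hiid : CoordsIID hE) (hreg : IsRegular E) {d : ℕ}
    (hd : 1 ≤ d) {P : Measure (ℕ → ℝ)} (hP : P ∈ dominated E)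
    (hPT : MeasurePreserving shift^[d] P P) {A : Set (ℕ → ℝ)} (hA : MeasurableSet A)
    (hAT : shift^[d] ⁻¹' A = A) (f : (ℕ → ℝ) →ᵇ ℝ) :
    ∫ ω in A, f ω ∂P ≤ P.real A * E f := by
  have := hP.1
  refine le_of_forall_pos_le_add fun ε hε => ?_
  obtain ⟨n, g, hg, hgf, h1, -⟩ := hE.exists_cylinder hreg f hε
  have h2 := hiid.setIntegral_le_of_isCylinder hreg hd hP hPT hA hAT hg
  have h3 : ∫ ω in A, f ω ∂P - ∫ ω in A, g ω ∂P = ∫ ω in A, (f - g) ω ∂P :=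
    (integral_sub (f.integrable _) (g.integrable _)).symm
  have h4 : ∫ ω in A, (f - g) ω ∂P ≤ ∫ ω, (f - g) ω ∂P :=
    setIntegral_le_integral (BoundedContinuousFunction.integrable P _)
      (Eventually.of_forall fun ω => sub_nonneg.2 (hgf ω))
  have h5 : P.real A * E g ≤ P.real A * E f :=
    mul_le_mul_of_nonneg_left (hE.mono hgf) measureReal_nonneg
  linarith [hP.2 (f - g)]

theorem CoordsIID.cond_mem_dominated (hiid : CoordsIID hE) (hreg : IsRegular E) {d : ℕ}
    (hd : 1 ≤ d) {P : Measure (ℕ → ℝ)} (hP : P ∈ dominated (component E shift d))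
    {A : Set (ℕ → ℝ)} (hA : MeasurableSet A) (hAT : shift^[d] ⁻¹' A = A) (hPA : P A ≠ 0) :
    (P A)⁻¹ • P.restrict A ∈ dominated (component E shift d) := by
  have hT := hiid.isInvariant hreg
  rw [mem_dominated_component_iff hE hT] at hP ⊢
  obtain ⟨hP, hPT⟩ := hP
  have := hP.1
  refine ⟨⟨⟨?_⟩, fun f => ?_⟩, ?_⟩
  · simp [ENNReal.inv_mul_cancel hPA (measure_ne_top P A)]
  · rw [integral_smul_measure, ENNReal.toReal_inv, smul_eq_mul,
      inv_mul_le_iff₀ (ENNReal.toReal_pos hPA (measure_ne_top P A))]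
    exact hiid.setIntegral_le hreg hd hP hPT hA hAT f
  · have h := hPT.restrict_preimage hA
    rw [hAT] at h
    exact h.smul_measure _

/-- If `A` and its complement both had positive mass, `P` would be a proper mixture of its two
conditionals, hence equal to the one on `A`, which does not charge the complement. -/
theorem CoordsIID.ergodic (hiid : CoordsIID hE) (hreg : IsRegular E) {d : ℕ}
    (hd : 1 ≤ d) {P : Measure (ℕ → ℝ)}
    (hP : P ∈ Set.extremePoints ℝ≥0∞ (dominated (component E shift d))) :
    Ergodic (shift^[d]) P := by
  have hPT := ((mem_dominated_component_iff hE (hiid.isInvariant hreg) d).1 hP.1).2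
  have := hP.1.1
  refine ⟨hPT, ⟨fun A hA hAT => ?_⟩⟩
  rw [eventuallyConst_set']
  by_cases h0 : P A = 0
  · exact Or.inl (ae_eq_empty.2 h0)
  by_cases h1 : P Aᶜ = 0
  · exact Or.inr (ae_eq_univ.2 h1)
  exfalso
  have hQ := hiid.cond_mem_dominated hreg hd hP.1 hA hAT h0
  have hR := hiid.cond_mem_dominated hreg hd hP.1 hA.compl
    (by rw [Set.preimage_compl, hAT]) h1
  have hseg : P ∈ openSegment ℝ≥0∞ ((P A)⁻¹ • P.restrict A) ((P Aᶜ)⁻¹ • P.restrict Aᶜ) := by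
    refine ⟨P A, P Aᶜ, pos_iff_ne_zero.2 h0, pos_iff_ne_zero.2 h1, prob_add_prob_compl hA, ?_⟩
    rw [smul_smul, smul_smul, ENNReal.mul_inv_cancel h0 (measure_ne_top P _),
      ENNReal.mul_inv_cancel h1 (measure_ne_top P _), one_smul, one_smul,
      Measure.restrict_add_restrict_compl hA]
  have heq := hP.2 hQ hR hseg
  refine h1 ?_
  rw [← heq]
  simp [Measure.restrict_apply hA.compl]

end Shift

end SublinearExp
end

theorem mainTheorem8 (E : ((ℕ → ℝ) →ᵇ ℝ) → ℝ)
    (hE : SublinearExp.IsSublinearExpectation E)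
    (hreg : SublinearExp.IsRegular E)
    (hiid : SublinearExp.CoordsIID hE) :
    (∀ d : ℕ, 1 ≤ d →
      (∀ f : (ℕ → ℝ) →ᵇ ℝ,
        Tendsto (fun n : ℕ => (1 / (n : ℝ)) *
            E (∑ k ∈ Finset.range n, (SublinearExp.koopman SublinearExp.shift)^[k * d] f))
          atTop (𝓝 (SublinearExp.component E SublinearExp.shift d f))) ∧
      SublinearExp.IsSublinearExpectation (SublinearExp.component E SublinearExp.shift d) ∧
      SublinearExp.IsInvariant (SublinearExp.component E SublinearExp.shift d)
        SublinearExp.shift) ∧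
    SublinearExp.HasPeriodicDecomposition E SublinearExp.shift ∧
    (∀ d : ℕ, 1 ≤ d →
      ∀ P ∈ Set.extremePoints ℝ≥0∞
          (SublinearExp.dominated (SublinearExp.component E SublinearExp.shift d)),
        Ergodic (SublinearExp.shift^[d]) P) ∧
    (¬ IsLinearMap ℝ E →
      ∀ d : ℕ, 1 ≤ d →
        SublinearExp.HasPeriod (SublinearExp.component E SublinearExp.shift d)
          SublinearExp.shift d) := by
  have hT := hiid.isInvariant hreg
  exact ⟨fun d _ => ⟨SublinearExp.tendsto_component hE hT d,
      SublinearExp.isSublinearExpectation_component hE hT hreg.isTightMeasureSet d,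
      SublinearExp.isInvariant_component hE hT d⟩,
    hiid.hasPeriodicDecomposition hreg,
    fun d hd P hP => hiid.ergodic hreg hd hP,
    fun hlin d hd => hiid.hasPeriod hreg hlin hd⟩
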